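/- **Notation.** $\|\cdot\|$ is the Euclidean norm of vectors, $\|A\|_2$ the spectral norm of a matrix, $\|s\|_0$ the number of nonzero entries of $s$. For $I\subseteq\{1,\dots,m\}$, $\pi_I(s)$ is the vector of the entries of $s\in\mathbb{R}^m$ indexed by $I$. For $A\in\mathbb{R}^{n\times m}$ and an integer $n_0\ge 0$ let $$\gamma_A(n_0)=\sup\Big\{\frac{\|\pi_I(s)\|^2}{\|\pi_{I^c}(s)\|^2}\;:\;|I|\le n_0,\ As=0,\ s\ne0\Big\}\in[0,\infty],$$ where a quotient with zero denominator counts as $\infty$. For $\gamma,\sigma>0$ let $F_{\gamma,\sigma}(s)=\sum_{i=1}^m f_\gamma(s_i/\sigma)$, where $f_\gamma(t)=1-\frac{t^2}{1+\gamma}$ for $|t|\le1$, $f_\gamma(t)=\frac{(|t|-\gamma-1)^2}{\gamma^2+\gamma}$ for $1\le|t|\le1+\gamma$, and $f_\gamma(t)=0$ for $|t|\ge1+\gamma$. **Algorithm (SL0).** Input: $A\in\mathbb{R}^{n\times m}$ with $n<m$ and $AA^T=I_n$; a matrix $D\in\mathbb{R}^{(m-n)\times m}$ with $DD^T=I_{m-n}$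 and $AD^T=0$; $x\in\mathbb{R}^n$; $n_0$ and the real number $\gamma=\gamma_A(n_0)$; an integer $k\ge0$; reals $\varepsilon,\delta$. Put $$\Delta=\frac{\frac{n_0}{2(1+\gamma)}-k}{4m},\qquad \gamma'=\frac{n_0}{2(k+3m\Delta)}-1,\qquad \delta'=\delta-\|A\|_2\,\varepsilon,$$ $$\sigma_1=\frac{\|A^Tx\|}{\sqrt{n_0/(2+2\gamma')}},\qquad \sigma_*=\frac{\delta'}{2\sqrt{m(\gamma'+1)}},\qquad J=\Big\lceil\frac{\log\sigma_1-\log\sigma_*}{\log(1+\Delta/2)}\Big\rceil+1,$$ $$\log c=-\frac{\log\sigma_1-\log\sigma_*}{J-1},\qquad \sigma_j=\sigma_1c^{\,j-1}\quad(1\le j\le J)$$ (so $\sigma_J=\sigma_*$ if $J\ge2$), $$\lambda'_{\max}=\frac{2}{1+\gamma},\quad \lambda'_{\min}=\frac{2(\gamma'-\gamma)}{(1+\gamma)(\gamma'^2+\gamma')},\quad \mu=\frac{2}{\lambda'_{\min}+\lambda'_{\max}},\quad \kappa'=\frac{\lambda'_{\max}}{\lambda'_{\min}},\quad \mathrm{CR}'=\frac{\kappa'-1}{\kappa'+1},$$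 $$L=\Big\lceil\frac{-\log(\Delta/4)-\frac12\log(\gamma'+1)}{-\log \mathrm{CR}'}\Big\rceil+1 .$$ Start with $s=A^Tx$. For $j=1,\dots,J$, perform $L-1$ times the update $$s\leftarrow s+\mu\,\sigma_j^2\,D^TD\,\nabla F_{\gamma',\sigma_j}(s).$$ The output $s_{out}$ is the final $s$. Conventions for degenerate inputs: if $J\le0$ the loop is empty and $s_{out}=A^Tx$; if $J=1$ the only value used is $\sigma_1$ and $c$ is irrelevant; if $x=0$ (so that $\sigma_1=0$) all the updates vanish and $s_{out}=0$. **Theorem.** Let $n<m$, let $A\in\mathbb{R}^{n\times m}$ have orthonormal rows, and let $D$ be as above. Let $n_0$ be such that $\gamma=\gamma_A(n_0)$ is finite (for instance, $n_0\le n$ and every $n\times n$ submatrix of $A$ is invertible). Let $x=As_0+\mathbf n$ with $s_0\in\mathbb{R}^m$, $\|\mathbf n\|\le\varepsilon$, and $\|s_0\|_0\le k<\frac{n_0}{2(1+\gamma)}$ with $k$ an integer. Put $$C=\Big(\frac{4}{\Delta\sqrt{\gamma+1}}+1\Big)\|A\|_2 .$$ Then for every $\delta>C\varepsilon$ the output of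 the algorithm above satisfies $\|s_{out}-s_0\|\le\delta$. -/

import Mathlib

open scoped ENNReal Matrix Gradient

noncomputable section

namespace SL0

/-- The matrix `M`, acting on Euclidean space. -/
def act {p q : ℕ} (M : Matrix (Fin p) (Fin q) ℝ) (s : EuclideanSpace ℝ (Fin q)) :
    EuclideanSpace ℝ (Fin p) :=
  WithLp.toLp 2 (M *ᵥ s.ofLp)

/-- The spectral norm `‖M‖₂` of a real matrix: the norm of the operator that `M` induces between
Euclidean spaces. -/
def specNorm {p q : ℕ} (M : Matrix (Fin p) (Fin q) ℝ) : ℝ :=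
  ‖(Matrix.toEuclideanLin M).toContinuousLinearMap‖

/-- The `ℓ⁰` norm: the number of nonzero entries. -/
def l0 {m : ℕ} (s : EuclideanSpace ℝ (Fin m)) : ℕ :=
  (Finset.univ.filter fun i => s i ≠ 0).card

/-- `π_I(s)`, the vector of the entries of `s` indexed by `I`. -/
def proj {m : ℕ} (I : Finset (Fin m)) (s : EuclideanSpace ℝ (Fin m)) : EuclideanSpace ℝ I :=
  WithLp.toLp 2 fun i => s i

/-- `γ_A(n₀)`: the largest value of `‖π_I(s)‖² / ‖π_{Iᶜ}(s)‖²` over all `|I| ≤ n₀` and all nonzero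
`s` in the null space of `A`, as an extended nonnegative real. A quotient with vanishing
denominator (its numerator is then positive) counts as `∞`. -/
def gammaConst {n m : ℕ} (A : Matrix (Fin n) (Fin m) ℝ) (n₀ : ℕ) : ℝ≥0∞ :=
  ⨆ (I : Finset (Fin m)) (_ : I.card ≤ n₀)
    (s : EuclideanSpace ℝ (Fin m)) (_ : act A s = 0) (_ : s ≠ 0),
      ‖proj I s‖ₑ ^ 2 / ‖proj Iᶜ s‖ₑ ^ 2

/-- The quadratic spline `f_γ`. -/
def spline (γ s : ℝ) : ℝ :=
  if |s| ≤ 1 then 1 - s ^ 2 / (1 + γ)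
  else if |s| ≤ 1 + γ then (|s| - γ - 1) ^ 2 / (γ ^ 2 + γ)
  else 0

/-- `F_{γ,σ}(s) = ∑ i, f_γ(s_i / σ)`. -/
def cost {m : ℕ} (γ σ : ℝ) (s : EuclideanSpace ℝ (Fin m)) : ℝ :=
  ∑ i, spline γ (s i / σ)

/-- The input of the algorithm: the matrix `A`, a matrix `D` completing the rows of `A`, the
measurement `x`, the numbers `n₀` and `γ` (meant to be `γ_A(n₀)`), the sparsity bound `k`, the
noise level `ε` and the prescribed accuracy `δ`. -/
structure Input (n m : ℕ) where
  A : Matrix (Fin n) (Fin m) ℝ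
  D : Matrix (Fin (m - n)) (Fin m) ℝ
  x : EuclideanSpace ℝ (Fin n)
  n₀ : ℕ
  γ : ℝ
  k : ℕ
  ε : ℝ
  δ : ℝ

namespace Input

variable {n m : ℕ} (P : Input n m)

def Δ : ℝ := (P.n₀ / (2 * (1 + P.γ)) - P.k) / (4 * m)

/-- The constant `C` of the error bound. -/
def C : ℝ := (4 / (P.Δ * √(P.γ + 1)) + 1) * specNorm P.A

/-- `γ'`, determined by `n₀ / (2 (1 + γ')) = k + 3 m Δ`. -/
def γ' : ℝ := P.n₀ / (2 * (P.k + 3 * m * P.Δ)) - 1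

def δ' : ℝ := P.δ - specNorm P.A * P.ε

/-- The first value of `σ`. -/
def σ₁ : ℝ := ‖act P.Aᵀ P.x‖ / √(P.n₀ / (2 + 2 * P.γ'))

/-- The last value `σ_J` of `σ`. -/
def σlast : ℝ := P.δ' / (2 * √(m * (P.γ' + 1)))

/-- The number of outer iterations. It is nonpositive if `σ₁` is much smaller than `σ_J`; the outer
loop is then empty. -/
def J : ℤ := ⌈(Real.log P.σ₁ - Real.log P.σlast) / Real.log (1 + P.Δ / 2)⌉ + 1

/-- The ratio of the `σ` sequence, given through its logarithm. It does not matter if `J ≤ 1`. -/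
def c : ℝ := Real.exp (-((Real.log P.σ₁ - Real.log P.σlast) / ((P.J : ℝ) - 1)))

/-- `σ_j = σ₁ c ^ (j - 1)`, for `j ≥ 1`. -/
def σ (j : ℕ) : ℝ := P.σ₁ * P.c ^ (j - 1)

def lamMax : ℝ := 2 / (1 + P.γ)

def lamMin : ℝ := 2 * (P.γ' - P.γ) / ((1 + P.γ) * (P.γ' ^ 2 + P.γ'))

def μ : ℝ := 2 / (P.lamMin + P.lamMax)

def κ' : ℝ := P.lamMax / P.lamMin

def CR' : ℝ := (P.κ' - 1) / (P.κ' + 1)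

/-- The inner loop makes `L - 1` steps. -/
def L : ℤ :=
  ⌈(-Real.log (P.Δ / 4) - 1 / 2 * Real.log (P.γ' + 1)) / (-Real.log P.CR')⌉ + 1

/-- One projected steepest ascent step for `F_{γ',σ}`. -/
def step (σ : ℝ) (s : EuclideanSpace ℝ (Fin m)) : EuclideanSpace ℝ (Fin m) :=
  s + (P.μ * σ ^ 2) • act (P.Dᵀ * P.D) (∇ (cost P.γ' σ) s)

/-- The estimate `s_{j,L}` after `j` outer iterations: `Aᵀ x` for `j = 0`, and outer iteration
`j + 1` makes `L - 1` steps with `σ = σ_{j+1}` from there. -/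
def estimate : ℕ → EuclideanSpace ℝ (Fin m)
  | 0 => act P.Aᵀ P.x
  | j + 1 => (P.step (P.σ (j + 1)))^[(P.L - 1).toNat] (estimate j)

/-- The output `s_{J,L}` of the algorithm. -/
def output : EuclideanSpace ℝ (Fin m) := P.estimate P.J.toNat

end Input

end SL0

end

/-! Call a vector feasible if `A` sends it to `x`. The target is replaced by the feasible `t = s₀ +
Aᵀ noise`, within `‖A‖₂ ε` of `s₀`.

An entry larger than `σ` costs `F_{γ',σ}` at least `1/(1+γ')`, so on the level set `F ≥ m -
n₀/(2(1+γ'))` at most `n₀/2` entries exceed `σ` (`card_large_le`). For two feasible vectors in this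
set, the difference lies in the null space and at most `n₀` coordinates are large in either. The
null space bound by `γ` then gives distance at most `2σ√(m(1+γ))` (`norm_sub_le`), and places minus
the difference quotients of the gradient, as a form on the null space, between `lamMin` and `lamMax`
(`quadratic_bounds`). So a step contracts by `CR'`; being also an ascent step, it preserves the
level set.

Run the inner loop from the current estimate and from `t` in parallel: the orbit of `t` does not
lose cost, and the other orbit approaches it geometrically (`cost_sub_le_cost_iterate`). No
maximizer is needed.

The budget is counted in units of `mΔ`: `F(t) ≥ m - k - mΔ`; the inner loop loses one unit and the
next decrease of `σ` another, ending at `m - k - 3mΔ`, which is the threshold by the choice of `γ'`.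
At the last `σ` the distance bound is at most `δ'`. -/

namespace SL0

/-! ### The spline, its slope and its curvature -/

/-- Truncation of a real number to the interval `[-r, r]`. -/
def clip (r t : ℝ) : ℝ := max (-r) (min r t)

/-- The antiderivative of `clip r` that vanishes at `0`. -/
noncomputable def huber (r t : ℝ) : ℝ := clip r t * t - clip r t ^ 2 / 2

theorem clip_of_abs_le {r t : ℝ} (h : |t| ≤ r) : clip r t = t := by
  rw [abs_le] at h
  rw [clip, min_eq_right h.2, max_eq_right h.1]

theorem clip_of_le {r t : ℝ} (hr : 0 ≤ r) (h : r ≤ t) : clip r t = r := by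
  rw [clip, min_eq_left h, max_eq_right (by linarith)]

theorem clip_of_le_neg {r t : ℝ} (hr : 0 ≤ r) (h : t ≤ -r) : clip r t = -r := by
  rw [clip, min_eq_right (by linarith), max_eq_left h]

theorem clip_cases {r : ℝ} (hr : 0 ≤ r) (t : ℝ) :
    (|t| ≤ r ∧ clip r t = t) ∨ (r ≤ t ∧ clip r t = r) ∨ (t ≤ -r ∧ clip r t = -r) := by
  rcases le_total |t| r with h | h
  · exact .inl ⟨h, clip_of_abs_le h⟩
  · rcases le_abs.1 h with h | h
    · exact .inr (.inl ⟨h, clip_of_le hr h⟩)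
    · exact .inr (.inr ⟨by linarith, clip_of_le_neg hr (by linarith)⟩)

/-- A quadratic error bound gives differentiability everywhere, including the points `±r` where the
formula changes. -/
theorem huber_remainder {r : ℝ} (hr : 0 ≤ r) (s t : ℝ) :
    |huber r s - huber r t - clip r t * (s - t)| ≤ (s - t) ^ 2 := by
  unfold huber
  rw [abs_le]
  rcases clip_cases hr s with ⟨h, e⟩ | ⟨h, e⟩ | ⟨h, e⟩ <;>
  rcases clip_cases hr t with ⟨h', e'⟩ | ⟨h', e'⟩ | ⟨h', e'⟩ <;>
  rw [e, e'] <;> (try rw [abs_le] at h) <;> (try rw [abs_le] at h') <;>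
  constructor <;> nlinarith [sq_nonneg (s - t)]

theorem hasDerivAt_huber {r : ℝ} (hr : 0 ≤ r) (t : ℝ) :
    HasDerivAt (huber r) (clip r t) t := by
  rw [hasDerivAt_iff_isLittleO]
  refine Asymptotics.IsBigO.trans_isLittleO (g := fun s => (s - t) ^ 2) ?_ ?_
  · refine Asymptotics.IsBigO.of_bound 1 (Filter.Eventually.of_forall fun s => ?_)
    simpa [mul_comm] using huber_remainder hr s t
  · simpa using (Asymptotics.isLittleO_pow_sub_sub t one_lt_two)

/-- The derivative of the quadratic spline. -/
noncomputable def splineDeriv (γ t : ℝ) : ℝ :=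
  2 / (γ ^ 2 + γ) * (clip (1 + γ) t - clip 1 t) - 2 / (1 + γ) * clip 1 t

theorem spline_eq {γ : ℝ} (hγ : 0 < γ) (t : ℝ) :
    spline γ t =
      1 + (2 / (γ ^ 2 + γ) * (huber (1 + γ) t - huber 1 t) - 2 / (1 + γ) * huber 1 t) := by
  have h1 : (1 + γ) ≠ 0 := by positivity
  have h2 : (γ ^ 2 + γ) = γ * (1 + γ) := by ring
  have hg : γ ≠ 0 := hγ.ne'
  unfold spline huber
  rw [h2]
  rcases clip_cases zero_le_one t with ⟨h, e⟩ | ⟨h, e⟩ | ⟨h, e⟩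
  · rw [if_pos h, e, clip_of_abs_le (by linarith)]
    field_simp
    ring
  · have ht : |t| = t := abs_of_nonneg (by linarith)
    rcases clip_cases (add_pos one_pos hγ).le t with ⟨h', e'⟩ | ⟨h', e'⟩ | ⟨h', e'⟩
    · rw [e, e', if_pos h', ht]
      split_ifs with h3
      · obtain rfl : t = 1 := le_antisymm h3 h
        field_simp
        ring
      · field_simp
        ring
    · rw [e, e', if_neg (by linarith), ht]
      split_ifs with h3
      · obtain rfl : t = 1 + γ := le_antisymm h3 h'
        field_simp
        ring
      · field_simp
        ring
    · linarith
  · have ht : |t| = -t := abs_of_nonpos (by linarith)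
    rcases clip_cases (add_pos one_pos hγ).le t with ⟨h', e'⟩ | ⟨h', e'⟩ | ⟨h', e'⟩
    · rw [e, e', if_pos h', ht]
      split_ifs with h3
      · obtain rfl : t = -1 := by linarith
        field_simp
        ring
      · field_simp
        ring
    · linarith
    · rw [e, e', if_neg (by linarith), ht]
      split_ifs with h3
      · obtain rfl : t = -(1 + γ) := by linarith
        field_simp
        ring
      · field_simp
        ring

theorem hasDerivAt_spline {γ : ℝ} (hγ : 0 < γ) (t : ℝ) :
    HasDerivAt (spline γ) (splineDeriv γ t) t := by
  have e : spline γ = fun t =>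
      1 + (2 / (γ ^ 2 + γ) * (huber (1 + γ) t - huber 1 t) - 2 / (1 + γ) * huber 1 t) :=
    funext (spline_eq hγ)
  have h1 := hasDerivAt_huber zero_le_one t
  have h2 := hasDerivAt_huber (add_pos one_pos hγ).le t
  rw [e]
  exact (((h2.sub h1).const_mul _).sub (h1.const_mul _)).const_add 1

theorem clip_increments {γ : ℝ} (hγ : 0 < γ) {a b : ℝ} (hab : b ≤ a) :
    0 ≤ clip 1 a - clip 1 b ∧
      clip 1 a - clip 1 b ≤ clip (1 + γ) a - clip (1 + γ) b ∧
      clip (1 + γ) a - clip (1 + γ) b ≤ a - b := by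
  unfold clip
  grind

/-- The difference quotient `h` of `-f'` stands in for a second derivative, which is missing at the
knots. The bounds follow because `clip 1` increases no faster than `clip (1 + γ)`, which is
1-Lipschitz. -/
theorem splineDeriv_slope_of_lt {γ : ℝ} (hγ : 0 < γ) {a b : ℝ} (hab : b < a) :
    ∃ h : ℝ, -(2 / (γ ^ 2 + γ)) ≤ h ∧ h ≤ 2 / (1 + γ) ∧
      (|a| ≤ 1 → |b| ≤ 1 → h = 2 / (1 + γ)) ∧
      splineDeriv γ a - splineDeriv γ b = -h * (a - b) := by
  obtain ⟨h0, h1, h2⟩ := clip_increments hγ hab.le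
  have hd : 0 < a - b := sub_pos.2 hab
  set u := clip 1 a - clip 1 b with hu
  set w := clip (1 + γ) a - clip (1 + γ) b with hw
  have hA : 0 < 2 / (1 + γ) := by positivity
  have hB : 0 < 2 / (γ ^ 2 + γ) := by positivity
  have hc : splineDeriv γ a - splineDeriv γ b =
      2 / (γ ^ 2 + γ) * (w - u) - 2 / (1 + γ) * u := by
    rw [hu, hw]; unfold splineDeriv; ring
  refine ⟨(2 / (1 + γ) * u - 2 / (γ ^ 2 + γ) * (w - u)) / (a - b), ?_, ?_, ?_, ?_⟩
  · rw [le_div_iff₀ hd]; nlinarith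
  · rw [div_le_iff₀ hd]; nlinarith
  · intro ha hb
    have e1 : u = a - b := by rw [hu, clip_of_abs_le ha, clip_of_abs_le hb]
    have e2 : w = a - b := by
      rw [hw, clip_of_abs_le (by linarith), clip_of_abs_le (by linarith)]
    rw [e1, e2]
    field_simp
    ring
  · rw [hc]
    field_simp
    ring

theorem splineDeriv_slope {γ : ℝ} (hγ : 0 < γ) (a b : ℝ) :
    ∃ h : ℝ, -(2 / (γ ^ 2 + γ)) ≤ h ∧ h ≤ 2 / (1 + γ) ∧
      (|a| ≤ 1 → |b| ≤ 1 → h = 2 / (1 + γ)) ∧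
      splineDeriv γ a - splineDeriv γ b = -h * (a - b) := by
  rcases lt_trichotomy a b with hab | rfl | hab
  · obtain ⟨h, h1, h2, h3, h4⟩ := splineDeriv_slope_of_lt hγ hab
    exact ⟨h, h1, h2, fun ha hb => h3 hb ha, by linear_combination -h4⟩
  · exact ⟨2 / (1 + γ), le_trans (neg_nonpos.2 (by positivity)) (by positivity), le_rfl,
      fun _ _ => rfl, by ring⟩
  · exact splineDeriv_slope_of_lt hγ hab

/-- The first bound controls the cost when the vector moves, the second when `σ` is rescaled. -/
theorem splineDeriv_bounds {γ : ℝ} (hγ : 0 < γ) (t : ℝ) :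
    |splineDeriv γ t| ≤ 2 / (1 + γ) ∧ |splineDeriv γ t * t| ≤ 2 := by
  have h2 : (γ ^ 2 + γ) = γ * (1 + γ) := by ring
  have key : splineDeriv γ t =
      2 * ((clip (1 + γ) t - clip 1 t) - γ * clip 1 t) / (γ * (1 + γ)) := by
    unfold splineDeriv
    rw [h2]
    field_simp
  have hp : 0 < γ * (1 + γ) := by positivity
  have e : 2 / (1 + γ) = 2 * γ / (γ * (1 + γ)) := by field_simp
  rw [key, e, div_mul_eq_mul_div, abs_div, abs_div, abs_of_pos hp, div_le_div_iff_of_pos_right hp,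
    div_le_iff₀ hp, abs_le, abs_le]
  rcases clip_cases zero_le_one t with ⟨h, e⟩ | ⟨h, e⟩ | ⟨h, e⟩
  · rw [e, clip_of_abs_le (by linarith)]
    rw [abs_le] at h
    have ht : γ * t ^ 2 ≤ γ :=
      mul_le_of_le_one_right hγ.le (by nlinarith)
    refine ⟨⟨?_, ?_⟩, ?_, ?_⟩ <;> nlinarith
  all_goals
    rcases clip_cases (add_pos one_pos hγ).le t with ⟨h', e'⟩ | ⟨h', e'⟩ | ⟨h', e'⟩ <;>
    rw [e, e'] <;> (try rw [abs_le] at h') <;>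
    refine ⟨⟨?_, ?_⟩, ?_, ?_⟩ <;> nlinarith [mul_pos hγ hγ]

theorem exists_spline_sub_eq {γ : ℝ} (hγ : 0 < γ) (a b : ℝ) :
    ∃ c ∈ Set.uIcc a b, spline γ b - spline γ a = splineDeriv γ c * (b - a) := by
  have hc : Continuous (spline γ) :=
    continuous_iff_continuousAt.2 fun t => (hasDerivAt_spline hγ t).continuousAt
  rcases lt_trichotomy a b with h | rfl | h
  · obtain ⟨c, hm, he⟩ := exists_hasDerivAt_eq_slope _ _ h hc.continuousOn
      fun t _ => hasDerivAt_spline hγ t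
    exact ⟨c, Set.Icc_subset_uIcc (Set.Ioo_subset_Icc_self hm), by
      rw [he, div_mul_cancel₀ _ (sub_pos.2 h).ne']⟩
  · exact ⟨a, by simp, by simp⟩
  · obtain ⟨c, hm, he⟩ := exists_hasDerivAt_eq_slope _ _ h hc.continuousOn
      fun t _ => hasDerivAt_spline hγ t
    refine ⟨c, Set.Icc_subset_uIcc' (Set.Ioo_subset_Icc_self hm), ?_⟩
    rw [he]
    have := (sub_pos.2 h).ne'
    field_simp
    ring

theorem abs_spline_sub_le {γ : ℝ} (hγ : 0 < γ) (a b : ℝ) :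
    |spline γ b - spline γ a| ≤ 2 / (1 + γ) * |b - a| := by
  obtain ⟨c, -, he⟩ := exists_spline_sub_eq hγ a b
  rw [he, abs_mul]
  exact mul_le_mul_of_nonneg_right (splineDeriv_bounds hγ c).1 (abs_nonneg _)

/-- A dilation of the argument by `r ≥ 1` changes the spline by at most `2 (r - 1)`. -/
theorem spline_le_spline_mul {γ : ℝ} (hγ : 0 < γ) {r : ℝ} (hr : 1 ≤ r) (t : ℝ) :
    spline γ t - 2 * (r - 1) ≤ spline γ (t * r) := by
  obtain ⟨c, hm, he⟩ := exists_spline_sub_eq hγ t (t * r)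
  have h1 := (splineDeriv_bounds hγ c).2
  -- The mean value point lies between `t` and `t * r`, hence no nearer to `0` than `t`; so the
  -- bound on `f'(c) c` also bounds `f'(c) t`.
  have h2 : |t| ≤ |c| := by
    rcases le_total 0 t with h | h
    · rw [Set.uIcc_of_le (by nlinarith)] at hm
      rw [abs_of_nonneg h, abs_of_nonneg (h.trans hm.1)]; exact hm.1
    · rw [Set.uIcc_of_ge (by nlinarith)] at hm
      rw [abs_of_nonpos h, abs_of_nonpos (hm.2.trans h)]; linarith [hm.2]
  have h3 : |splineDeriv γ c * (t * r - t)| ≤ 2 * (r - 1) := by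
    have : t * r - t = t * (r - 1) := by ring
    rw [this, ← mul_assoc, abs_mul, abs_of_nonneg (sub_nonneg.2 hr)]
    refine mul_le_mul_of_nonneg_right ?_ (sub_nonneg.2 hr)
    rw [abs_mul] at h1 ⊢
    exact (mul_le_mul_of_nonneg_left h2 (abs_nonneg _)).trans h1
  have := (abs_le.1 (he ▸ h3)).1
  linarith

/-- The quadratic lower bound of the spline at an arbitrary point. -/
theorem spline_quadratic_lower {γ : ℝ} (hγ : 0 < γ) (a b : ℝ) :
    spline γ a + splineDeriv γ a * (b - a) - (b - a) ^ 2 / (1 + γ) ≤ spline γ b := by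
  -- Adding `t²/(1+γ)` cancels the strongest concavity of the spline; the claim is the tangent line
  -- inequality for the resulting convex function.
  have hh : ∀ t, HasDerivAt (fun t => spline γ t + t ^ 2 / (1 + γ))
      (splineDeriv γ t + 2 * t / (1 + γ)) t := fun t => by
    simpa using (hasDerivAt_spline hγ t).fun_add ((hasDerivAt_pow 2 t).div_const (1 + γ))
  have hm : Monotone (deriv fun t => spline γ t + t ^ 2 / (1 + γ)) := by
    intro p q hpq
    rw [(hh p).deriv, (hh q).deriv]
    obtain ⟨h, -, h2, -, h4⟩ := splineDeriv_slope hγ q p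
    have : 2 * q / (1 + γ) - 2 * p / (1 + γ) = 2 / (1 + γ) * (q - p) := by ring
    nlinarith
  have hcv : ConvexOn ℝ Set.univ fun t => spline γ t + t ^ 2 / (1 + γ) :=
    hm.convexOn_univ_of_deriv fun t => (hh t).differentiableAt
  have key : (splineDeriv γ a + 2 * a / (1 + γ)) * (b - a) ≤
      (spline γ b + b ^ 2 / (1 + γ)) - (spline γ a + a ^ 2 / (1 + γ)) := by
    rcases lt_trichotomy a b with h | rfl | h
    · have := hcv.le_slope_of_hasDerivAt (Set.mem_univ a) (Set.mem_univ b) h (hh a)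
      rw [slope_def_field, le_div_iff₀ (sub_pos.2 h)] at this
      exact this
    · simp
    · have := hcv.slope_le_of_hasDerivAt (Set.mem_univ b) (Set.mem_univ a) h (hh a)
      rw [slope_def_field, div_le_iff₀ (sub_pos.2 h)] at this
      linarith
  have e : (b - a) ^ 2 / (1 + γ) =
      b ^ 2 / (1 + γ) - a ^ 2 / (1 + γ) - 2 * a / (1 + γ) * (b - a) := by ring
  rw [e]
  linarith

theorem one_sub_sq_le_spline {γ : ℝ} (hγ : 0 < γ) (t : ℝ) : 1 - t ^ 2 / (1 + γ) ≤ spline γ t := by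
  have h := spline_quadratic_lower hγ 0 t
  have h0 : spline γ 0 = 1 := by simp [spline]
  have h1 : splineDeriv γ 0 = 0 := by
    rw [splineDeriv, clip_of_abs_le (by simp; positivity), clip_of_abs_le (by simp)]; simp
  rw [h0, h1] at h
  simpa using h

theorem spline_nonneg {γ : ℝ} (hγ : 0 < γ) (t : ℝ) : 0 ≤ spline γ t := by
  unfold spline
  split_ifs with h
  · have : t ^ 2 ≤ 1 := by rw [← sq_abs]; nlinarith [abs_nonneg t]
    have : t ^ 2 / (1 + γ) ≤ 1 := by rw [div_le_one (by positivity)]; linarith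
    linarith
  · positivity
  · exact le_rfl

theorem spline_le_one {γ : ℝ} (hγ : 0 < γ) {t : ℝ} : spline γ t ≤ 1 := by
  unfold spline
  split_ifs with h h'
  · have : 0 ≤ t ^ 2 / (1 + γ) := by positivity
    linarith
  · rw [div_le_one (by positivity)]; nlinarith
  · exact zero_le_one

theorem spline_le_of_one_lt {γ : ℝ} (hγ : 0 < γ) {t : ℝ} (ht : 1 < |t|) :
    spline γ t ≤ 1 - 1 / (1 + γ) := by
  have e : 1 - 1 / (1 + γ) = γ / (1 + γ) := by field_simp; ring
  rw [e]
  unfold spline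
  rw [if_neg (not_le.2 ht)]
  split_ifs with h'
  · rw [div_le_div_iff₀ (by positivity) (by positivity)]
    have : (|t| - γ - 1) ^ 2 ≤ γ ^ 2 := by nlinarith
    nlinarith [mul_le_mul_of_nonneg_right this (add_pos one_pos hγ).le]
  · positivity

/-! ### Matrices on Euclidean space and the null space constant -/

section Linear

variable {p q r : ℕ}

theorem act_eq_toEuclideanLin (M : Matrix (Fin p) (Fin q) ℝ) (s : EuclideanSpace ℝ (Fin q)) :
    act M s = Matrix.toEuclideanLin M s := rfl

theorem act_add (M : Matrix (Fin p) (Fin q) ℝ) (s t : EuclideanSpace ℝ (Fin q)) :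
    act M (s + t) = act M s + act M t := by
  simp only [act_eq_toEuclideanLin, map_add]

theorem act_sub (M : Matrix (Fin p) (Fin q) ℝ) (s t : EuclideanSpace ℝ (Fin q)) :
    act M (s - t) = act M s - act M t := by
  simp only [act_eq_toEuclideanLin, map_sub]

theorem act_smul (M : Matrix (Fin p) (Fin q) ℝ) (a : ℝ) (s : EuclideanSpace ℝ (Fin q)) :
    act M (a • s) = a • act M s := by
  simp only [act_eq_toEuclideanLin, map_smul]

theorem act_act (M : Matrix (Fin p) (Fin q) ℝ) (N : Matrix (Fin q) (Fin r) ℝ)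
    (s : EuclideanSpace ℝ (Fin r)) : act M (act N s) = act (M * N) s := by
  simp [act, Matrix.mulVec_mulVec]

theorem act_one (s : EuclideanSpace ℝ (Fin p)) : act 1 s = s := by
  simp [act]

theorem act_zero_left (s : EuclideanSpace ℝ (Fin q)) :
    act (0 : Matrix (Fin p) (Fin q) ℝ) s = 0 := by
  simp [act]

theorem act_zero_right (M : Matrix (Fin p) (Fin q) ℝ) : act M 0 = 0 := by
  simp [act]

theorem inner_act_left (M : Matrix (Fin p) (Fin q) ℝ) (s : EuclideanSpace ℝ (Fin q))
    (t : EuclideanSpace ℝ (Fin p)) : inner ℝ (act M s) t = inner ℝ s (act Mᵀ t) := by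
  simp only [act, EuclideanSpace.inner_eq_star_dotProduct, star_trivial]
  rw [Matrix.dotProduct_mulVec, Matrix.mulVec_transpose]

theorem norm_act_le (M : Matrix (Fin p) (Fin q) ℝ) (s : EuclideanSpace ℝ (Fin q)) :
    ‖act M s‖ ≤ specNorm M * ‖s‖ :=
  (Matrix.toEuclideanLin M).toContinuousLinearMap.le_opNorm s

theorem norm_act_transpose {M : Matrix (Fin p) (Fin q) ℝ} (hM : M * Mᵀ = 1)
    (s : EuclideanSpace ℝ (Fin p)) : ‖act Mᵀ s‖ = ‖s‖ := by
  have h : inner ℝ (act Mᵀ s) (act Mᵀ s) = inner ℝ s s := by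
    rw [inner_act_left, Matrix.transpose_transpose, act_act, hM, act_one]
  rw [real_inner_self_eq_norm_sq, real_inner_self_eq_norm_sq] at h
  exact (sq_eq_sq₀ (norm_nonneg _) (norm_nonneg _)).1 h

/-- This form also covers `p = 0`, where the spectral norm is `0` rather than `1`. -/
theorem norm_act_transpose_le {M : Matrix (Fin p) (Fin q) ℝ} (hM : M * Mᵀ = 1)
    (s : EuclideanSpace ℝ (Fin p)) : ‖act Mᵀ s‖ ≤ specNorm M * ‖s‖ := by
  have h := norm_act_le M (act Mᵀ s)
  rw [act_act, hM, act_one] at h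
  rwa [norm_act_transpose hM] at h ⊢

/-- Two matrices with orthonormal and mutually orthogonal rows that together have as many rows as
columns: their row spaces are complementary. -/
theorem transpose_mul_self_add {M : Matrix (Fin p) (Fin q) ℝ} {N : Matrix (Fin r) (Fin q) ℝ}
    (hM : M * Mᵀ = 1) (hN : N * Nᵀ = 1) (hMN : M * Nᵀ = 0) (hq : p + r = q) :
    Mᵀ * M + Nᵀ * N = 1 := by
  have hNM : N * Mᵀ = 0 := by
    rw [← Matrix.transpose_transpose N, ← Matrix.transpose_mul, hMN, Matrix.transpose_zero]
  have h : Matrix.fromRows M N * (Matrix.fromRows M N)ᵀ = 1 := by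
    rw [Matrix.transpose_fromRows, Matrix.fromRows_mul_fromCols, hM, hN, hMN, hNM,
      Matrix.fromBlocks_one]
  have h' := (Matrix.mul_eq_one_comm_of_card_eq _ _ _ (by simp [hq])).1 h
  rwa [Matrix.transpose_fromRows, Matrix.fromCols_mul_fromRows] at h'

end Linear

theorem norm_proj_sq {m : ℕ} (I : Finset (Fin m)) (s : EuclideanSpace ℝ (Fin m)) :
    ‖proj I s‖ ^ 2 = ∑ i ∈ I, s i ^ 2 := by
  rw [EuclideanSpace.real_norm_sq_eq]
  exact Finset.sum_coe_sort I fun i => s i ^ 2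

/-- The defining property of `γ_A(n₀)`, without quotients. -/
theorem sum_sq_le_gammaConst {n m : ℕ} {A : Matrix (Fin n) (Fin m) ℝ} {n₀ : ℕ}
    (hfin : gammaConst A n₀ ≠ ⊤) {I : Finset (Fin m)} (hI : I.card ≤ n₀)
    {s : EuclideanSpace ℝ (Fin m)} (hs : act A s = 0) :
    ∑ i ∈ I, s i ^ 2 ≤ (gammaConst A n₀).toReal * ∑ i ∈ Iᶜ, s i ^ 2 := by
  by_cases h0 : s = 0
  · simp [h0]
  have h : ‖proj I s‖ₑ ^ 2 / ‖proj Iᶜ s‖ₑ ^ 2 ≤ gammaConst A n₀ :=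
    le_iSup₂_of_le I hI (le_iSup₂_of_le s hs (le_iSup_of_le h0 le_rfl))
  -- Finiteness of the constant is what permits clearing a denominator that may vanish.
  rw [ENNReal.div_le_iff_le_mul (.inr hfin) (.inl (by finiteness))] at h
  have h' := ENNReal.toReal_mono (by finiteness) h
  simpa [← norm_proj_sq] using h'

/-! ### The cost function -/

theorem hasGradientAt_cost {m : ℕ} {γ : ℝ} (hγ : 0 < γ) (σ : ℝ) (s : EuclideanSpace ℝ (Fin m)) :
    HasGradientAt (cost γ σ) (WithLp.toLp 2 fun i => splineDeriv γ (s i / σ) / σ) s := by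
  rw [hasGradientAt_iff_hasFDerivAt]
  have h : ∀ i : Fin m, HasFDerivAt (fun s : EuclideanSpace ℝ (Fin m) => spline γ (s i / σ))
      ((splineDeriv γ (s i / σ) / σ) • (EuclideanSpace.proj i : EuclideanSpace ℝ (Fin m) →L[ℝ] ℝ))
      s := fun i => by
    have h1 : HasDerivAt (fun t => spline γ (t / σ)) (splineDeriv γ (s i / σ) / σ) (s i) := by
      have h0 := (hasDerivAt_spline hγ (s i / σ)).comp (s i) ((hasDerivAt_id' (s i)).div_const σ)
      rwa [mul_one_div] at h0
    exact h1.comp_hasFDerivAt s (EuclideanSpace.proj i : EuclideanSpace ℝ (Fin m) →L[ℝ] ℝ).hasFDerivAt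
  have hs := HasFDerivAt.fun_sum (u := Finset.univ) fun i _ => h i
  refine hs.congr_fderiv ?_
  ext v
  simp [PiLp.inner_apply, mul_comm]

/-- The entries of absolute value greater than `σ`. -/
noncomputable def large {m : ℕ} (σ : ℝ) (s : EuclideanSpace ℝ (Fin m)) : Finset (Fin m) :=
  Finset.univ.filter fun i => σ < |s i|

theorem large_subset {m : ℕ} {σ τ : ℝ} (h : σ ≤ τ) (s : EuclideanSpace ℝ (Fin m)) :
    large τ s ⊆ large σ s :=
  Finset.monotone_filter_right _ fun _ _ hi => h.trans_lt hi

/-- A high value of the cost function leaves room for few large entries only. -/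
theorem card_large_le {m n₀ : ℕ} {γ σ : ℝ} (hγ : 0 < γ) (hσ : 0 < σ)
    {s : EuclideanSpace ℝ (Fin m)} (h : m - n₀ / (2 * (1 + γ)) ≤ cost γ σ s) :
    2 * (large σ s).card ≤ n₀ := by
  have h1 : cost γ σ s ≤ ∑ i, (1 - if σ < |s i| then 1 / (1 + γ) else 0) := by
    refine Finset.sum_le_sum fun i _ => ?_
    split_ifs with hi
    · refine spline_le_of_one_lt hγ ?_
      rwa [abs_div, abs_of_pos hσ, one_lt_div hσ]
    · simpa using spline_le_one hγ
  have h2 : ∑ i, (1 - if σ < |s i| then 1 / (1 + γ) else 0) =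
      m - (large σ s).card * (1 / (1 + γ)) := by
    simp [Finset.sum_sub_distrib, ← Finset.sum_filter, large]
  have hp : 0 < 1 + γ := by positivity
  have h3 : (large σ s).card * (1 / (1 + γ)) ≤ n₀ / (2 * (1 + γ)) := by linarith
  rw [mul_one_div, div_le_div_iff₀ hp (by positivity)] at h3
  have h4 : (2 * (large σ s).card : ℝ) ≤ n₀ := by
    refine le_of_mul_le_mul_right ?_ hp
    linarith
  exact_mod_cast h4

theorem sub_sq_le_cost {m : ℕ} {γ σ : ℝ} (hγ : 0 < γ) (s : EuclideanSpace ℝ (Fin m)) :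
    m - ‖s‖ ^ 2 / (σ ^ 2 * (1 + γ)) ≤ cost γ σ s := by
  have : ∑ i, (1 - (s i / σ) ^ 2 / (1 + γ)) ≤ cost γ σ s :=
    Finset.sum_le_sum fun i _ => one_sub_sq_le_spline hγ _
  refine le_trans (le_of_eq ?_) this
  simp [Finset.sum_sub_distrib, EuclideanSpace.real_norm_sq_eq, Finset.sum_div, div_pow, div_div]

/-- The cost function at a perturbation of a sparse vector. -/
theorem sub_l0_sub_le_cost_add {m : ℕ} {γ σ : ℝ} (hγ : 0 < γ) (s w : EuclideanSpace ℝ (Fin m)) :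
    m - l0 s - ‖w‖ ^ 2 / (σ ^ 2 * (1 + γ)) ≤ cost γ σ (s + w) := by
  have : ∑ i, (1 - (if s i ≠ 0 then 1 else 0) - (w i / σ) ^ 2 / (1 + γ)) ≤ cost γ σ (s + w) := by
    refine Finset.sum_le_sum fun i _ => ?_
    split_ifs with hi
    · have h1 : 0 ≤ (w i / σ) ^ 2 / (1 + γ) := by positivity
      have h2 := spline_nonneg hγ ((s + w) i / σ)
      linarith
    · have := one_sub_sq_le_spline hγ (w i / σ)
      rw [not_not] at hi
      simpa [hi] using this
  refine le_trans (le_of_eq ?_) this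
  rw [Finset.sum_sub_distrib, Finset.sum_sub_distrib]
  simp [EuclideanSpace.real_norm_sq_eq, Finset.sum_div, div_pow, div_div, l0, Finset.card_filter]

/-- Each coordinate is dilated by `c⁻¹ ≤ 1 + d`. With `d = Δ/2` the loss is one unit `mΔ`. -/
theorem cost_sub_le_cost_mul {m : ℕ} {γ σ c d : ℝ} (hγ : 0 < γ) (hc : 0 < c) (hc1 : c ≤ 1)
    (hd : 1 ≤ c * (1 + d)) (s : EuclideanSpace ℝ (Fin m)) :
    cost γ σ s - m * (2 * d) ≤ cost γ (σ * c) s := by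
  have h1 : 1 ≤ c⁻¹ := (one_le_inv₀ hc).2 hc1
  have h2 : c⁻¹ - 1 ≤ d := by
    have : c⁻¹ ≤ 1 + d := by rw [inv_le_iff_one_le_mul₀ hc]; linarith
    linarith
  have : ∑ i, (spline γ (s i / σ) - 2 * d) ≤ cost γ (σ * c) s := by
    refine Finset.sum_le_sum fun i _ => ?_
    have h3 := spline_le_spline_mul hγ h1 (s i / σ)
    have e : s i / (σ * c) = s i / σ * c⁻¹ := by
      rw [div_mul_eq_div_div, div_eq_mul_inv (s i / σ) c]
    rw [e]
    linarith
  refine le_trans (le_of_eq ?_) this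
  simp [Finset.sum_sub_distrib, cost]

theorem cost_sub_le_of_norm {m : ℕ} {γ σ : ℝ} (hγ : 0 < γ) (hσ : 0 < σ)
    (s t : EuclideanSpace ℝ (Fin m)) :
    cost γ σ t - 2 / (1 + γ) * (√m * ‖s - t‖ / σ) ≤ cost γ σ s := by
  have h1 : ∑ i, (spline γ (t i / σ) - 2 / (1 + γ) * (|s i - t i| / σ)) ≤ cost γ σ s := by
    refine Finset.sum_le_sum fun i _ => ?_
    have := (abs_le.1 (abs_spline_sub_le hγ (t i / σ) (s i / σ))).1
    rw [← sub_div, abs_div, abs_of_pos hσ] at this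
    linarith
  have h2 : ∑ i, |s i - t i| ≤ √m * ‖s - t‖ := by
    refine abs_le_of_sq_le_sq' ?_ (by positivity) |>.2
    rw [mul_pow, Real.sq_sqrt (by positivity), EuclideanSpace.real_norm_sq_eq]
    have := sq_sum_le_card_mul_sum_sq (s := Finset.univ) (f := fun i : Fin m => |s i - t i|)
    simpa using this
  refine le_trans ?_ h1
  rw [Finset.sum_sub_distrib, ← Finset.mul_sum, ← Finset.sum_div]
  have : 2 / (1 + γ) * ((∑ i, |s i - t i|) / σ) ≤ 2 / (1 + γ) * (√m * ‖s - t‖ / σ) := by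
    gcongr
  unfold cost
  linarith

theorem cost_quadratic_lower {m : ℕ} {γ : ℝ} (hγ : 0 < γ) (σ : ℝ)
    (s v : EuclideanSpace ℝ (Fin m)) :
    cost γ σ s + inner ℝ (∇ (cost γ σ) s) v - ‖v‖ ^ 2 / (σ ^ 2 * (1 + γ)) ≤ cost γ σ (s + v) := by
  rw [(hasGradientAt_cost hγ σ s).gradient]
  have : ∑ i, (spline γ (s i / σ) + splineDeriv γ (s i / σ) / σ * v i
      - v i ^ 2 / (σ ^ 2 * (1 + γ))) ≤ cost γ σ (s + v) := by
    refine Finset.sum_le_sum fun i _ => ?_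
    have h := spline_quadratic_lower hγ (s i / σ) ((s + v) i / σ)
    have e : (s + v) i / σ - s i / σ = v i / σ := by simp [add_div]
    rw [e, div_pow, div_div, ← mul_div_assoc, mul_div_right_comm] at h
    exact h
  refine le_trans (le_of_eq ?_) this
  simp [Finset.sum_sub_distrib, Finset.sum_add_distrib, EuclideanSpace.real_norm_sq_eq,
    Finset.sum_div, cost, PiLp.inner_apply, mul_comm]

/-- A diagonal quadratic form that is bounded by `c` on a subspace `N` has a compression to `N` of
norm at most `c`; here `w` is the image of `v` under the compression. -/
theorem norm_compression_le {m : ℕ} {c : ℝ} (hc : 0 < c) (d : Fin m → ℝ)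
    (N : Submodule ℝ (EuclideanSpace ℝ (Fin m)))
    (hN : ∀ w ∈ N, |∑ i, d i * w i ^ 2| ≤ c * ‖w‖ ^ 2)
    {v w : EuclideanSpace ℝ (Fin m)} (hv : v ∈ N) (hw : w ∈ N)
    (hvw : ‖w‖ ^ 2 = ∑ i, d i * v i * w i) : ‖w‖ ≤ c * ‖v‖ := by
  -- Polarization: with `Q` the form, `4c‖w‖² = Q(cv + w) - Q(cv - w)`, at most `2c(c²‖v‖² + ‖w‖²)`
  -- by the parallelogram law.
  have h1 := (abs_le.1 (hN _ (N.add_mem (N.smul_mem c hv) hw))).2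
  have h2 := (abs_le.1 (hN _ (N.sub_mem (N.smul_mem c hv) hw))).1
  have hp := parallelogram_law_with_norm ℝ (c • v) w
  have e : ∑ i, d i * (c • v + w) i ^ 2 - ∑ i, d i * (c • v - w) i ^ 2 = 4 * c * ‖w‖ ^ 2 := by
    rw [hvw, ← Finset.sum_sub_distrib, Finset.mul_sum]
    refine Finset.sum_congr rfl fun i _ => ?_
    simp only [PiLp.add_apply, PiLp.sub_apply, PiLp.smul_apply, smul_eq_mul]
    ring
  have hs : ‖c • v‖ = c * ‖v‖ := by rw [norm_smul, Real.norm_of_nonneg hc.le]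
  rw [hs] at hp
  refine abs_le_of_sq_le_sq' ?_ (by positivity) |>.2
  nlinarith

/-! ### Consequences of the choice of parameters -/

namespace Input

variable {n m : ℕ} {P : Input n m}

/-- The assumptions on the input, with `γ` being an upper bound for the quotients in the definition
of `γ_A(n₀)`. -/
structure Admissible (P : Input n m) : Prop where
  lt : n < m
  rows_A : P.A * P.Aᵀ = 1
  rows_D : P.D * P.Dᵀ = 1
  orthogonal : P.A * P.Dᵀ = 0
  γ_nonneg : 0 ≤ P.γ
  null : ∀ I : Finset (Fin m), I.card ≤ P.n₀ → ∀ s : EuclideanSpace ℝ (Fin m), act P.A s = 0 →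
    ∑ i ∈ I, s i ^ 2 ≤ P.γ * ∑ i ∈ Iᶜ, s i ^ 2
  sparse : (P.k : ℝ) < P.n₀ / (2 * (1 + P.γ))

namespace Admissible

theorem m_pos (h : P.Admissible) : (0 : ℝ) < m := by
  have := h.lt
  exact_mod_cast (by omega : 0 < m)

theorem completeness (h : P.Admissible) : P.Aᵀ * P.A + P.Dᵀ * P.D = 1 :=
  transpose_mul_self_add h.rows_A h.rows_D h.orthogonal (by have := h.lt; omega)

theorem act_A_proj (h : P.Admissible) (s : EuclideanSpace ℝ (Fin m)) : act P.A (act (P.Dᵀ * P.D) s) = 0 := by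
  rw [act_act, ← Matrix.mul_assoc, h.orthogonal, Matrix.zero_mul, act_zero_left]

theorem proj_eq_self (h : P.Admissible) {s : EuclideanSpace ℝ (Fin m)} (hs : act P.A s = 0) :
    act (P.Dᵀ * P.D) s = s := by
  have e : P.Dᵀ * P.D = 1 - P.Aᵀ * P.A := eq_sub_of_add_eq' h.completeness
  have e' : act (1 - P.Aᵀ * P.A) s = act 1 s - act (P.Aᵀ * P.A) s := by
    simp [act, Matrix.sub_mulVec]
  rw [e, e', act_one, ← act_act, hs, act_zero_right, sub_zero]

theorem inner_proj (h : P.Admissible) (s : EuclideanSpace ℝ (Fin m)) {t : EuclideanSpace ℝ (Fin m)}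
    (ht : act P.A t = 0) : inner ℝ (act (P.Dᵀ * P.D) s) t = inner ℝ s t := by
  rw [inner_act_left, Matrix.transpose_mul, Matrix.transpose_transpose, h.proj_eq_self ht]

theorem norm_proj_sq_eq (h : P.Admissible) (s : EuclideanSpace ℝ (Fin m)) :
    ‖act (P.Dᵀ * P.D) s‖ ^ 2 = inner ℝ s (act (P.Dᵀ * P.D) s) := by
  rw [← real_inner_self_eq_norm_sq, h.inner_proj _ (h.act_A_proj s)]

/-- Otherwise the set of all indices is allowed and null vectors must vanish, but the rows of `D`
are unit null vectors. -/
theorem n₀_le (h : P.Admissible) : P.n₀ ≤ m := by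
  by_contra! hm
  have hD : 0 < m - n := Nat.sub_pos_of_lt h.lt
  let e : EuclideanSpace ℝ (Fin (m - n)) := EuclideanSpace.single ⟨0, hD⟩ 1
  have h1 := h.null Finset.univ (by simpa using hm.le) (act P.Dᵀ e)
    (by rw [act_act, h.orthogonal, act_zero_left])
  have h2 : ‖act P.Dᵀ e‖ = 1 := by rw [norm_act_transpose h.rows_D]; simp [e]
  rw [← EuclideanSpace.real_norm_sq_eq, h2] at h1
  norm_num at h1

theorem Δ_pos (h : P.Admissible) : 0 < P.Δ := by
  have := h.m_pos
  have := h.sparse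
  unfold Δ
  apply div_pos <;> linarith

theorem four_mul_Δ (h : P.Admissible) : P.k + 4 * m * P.Δ = P.n₀ / (2 * (1 + P.γ)) := by
  have := h.m_pos
  unfold Δ
  field_simp
  ring

theorem Δ_mul_le (h : P.Admissible) : P.Δ * (1 + P.γ) ≤ 1 / 8 := by
  have hm := h.m_pos
  have hγ := h.γ_nonneg
  have e : (P.k + 4 * m * P.Δ) * (2 * (1 + P.γ)) = P.n₀ := by
    rw [h.four_mul_Δ]; field_simp
  have hn : (P.n₀ : ℝ) ≤ m := by exact_mod_cast h.n₀_le
  have hk : 0 ≤ (P.k : ℝ) * (2 * (1 + P.γ)) := by positivity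
  have : m * (8 * (P.Δ * (1 + P.γ))) ≤ m * 1 := by linarith
  linarith [le_of_mul_le_mul_left this hm]

theorem Δ_le (h : P.Admissible) : P.Δ ≤ 1 / 8 := by
  have := h.Δ_mul_le
  nlinarith [h.Δ_pos, h.γ_nonneg]

theorem n₀_pos (h : P.Admissible) : (0 : ℝ) < P.n₀ := by
  have hγ := h.γ_nonneg
  have := (Nat.cast_nonneg P.k).trans_lt h.sparse
  by_contra! hn
  have : (P.n₀ : ℝ) / (2 * (1 + P.γ)) ≤ 0 := div_nonpos_of_nonpos_of_nonneg hn (by positivity)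
  linarith

/-- The level `k + 3mΔ` defining `γ'` is below `k + 4mΔ`, the one belonging to `γ`. This gap makes
`lamMin` positive. -/
theorem γ_lt_γ' (h : P.Admissible) : P.γ < P.γ' := by
  have hm := h.m_pos
  have hγ := h.γ_nonneg
  have hΔ := h.Δ_pos
  have e : (P.k + 4 * m * P.Δ) * (2 * (1 + P.γ)) = P.n₀ := by
    rw [h.four_mul_Δ]; field_simp
  have hp : 0 < m * P.Δ := mul_pos hm hΔ
  unfold γ'
  rw [lt_sub_iff_add_lt, lt_div_iff₀ (by positivity), ← e]
  nlinarith

theorem γ'_pos (h : P.Admissible) : 0 < P.γ' := h.γ_nonneg.trans_lt h.γ_lt_γ'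

theorem div_one_add_γ' (h : P.Admissible) : P.n₀ / (2 * (1 + P.γ')) = P.k + 3 * m * P.Δ := by
  have hm := h.m_pos
  have hΔ := h.Δ_pos
  have hn := h.n₀_pos
  have e : 1 + P.γ' = P.n₀ / (2 * (P.k + 3 * m * P.Δ)) := by unfold γ'; ring
  rw [e]
  field_simp

theorem lamMin_pos (h : P.Admissible) : 0 < P.lamMin := by
  have := h.γ_nonneg
  have := h.γ'_pos
  have := sub_pos.2 h.γ_lt_γ'
  unfold lamMin
  positivity

theorem lamMin_lt_lamMax (h : P.Admissible) : P.lamMin < P.lamMax := by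
  have := h.γ_nonneg
  have h' := h.γ'_pos
  unfold lamMin lamMax
  rw [div_lt_div_iff₀ (by positivity) (by positivity)]
  have : P.γ' - P.γ < P.γ' ^ 2 + P.γ' := by nlinarith
  nlinarith [mul_lt_mul_of_pos_right this (by positivity : 0 < 2 * (1 + P.γ))]

theorem μ_pos (h : P.Admissible) : 0 < P.μ := by
  have := h.lamMin_pos
  have := h.lamMin_lt_lamMax
  unfold μ
  apply div_pos <;> linarith

/-- The step size balances the two ends of the spectrum: `1 - μλ` is `-CR'` at `lamMax` and `CR'` at
`lamMin`. -/
theorem μ_mul_lamMax (h : P.Admissible) : P.μ * P.lamMax = 1 + P.CR' := by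
  have := h.lamMin_pos
  have := this.trans h.lamMin_lt_lamMax
  unfold μ CR' κ'
  field_simp
  ring

theorem μ_mul_lamMin (h : P.Admissible) : P.μ * P.lamMin = 1 - P.CR' := by
  have := h.lamMin_pos
  have := this.trans h.lamMin_lt_lamMax
  unfold μ CR' κ'
  field_simp
  ring

/-- This is the ascent condition: the gain of a step is a nonnegative multiple of `1 - μ/(1+γ')`. -/
theorem μ_le (h : P.Admissible) : P.μ ≤ 1 + P.γ' := by
  have hγ := h.γ_nonneg
  have h1 := h.lamMin_pos
  have h2 : P.lamMax * (1 + P.γ) = 2 := by unfold lamMax; field_simp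
  have h3 := h.γ_lt_γ'
  unfold μ
  have : 0 < P.lamMax := h1.trans h.lamMin_lt_lamMax
  rw [div_le_iff₀ (by positivity)]
  nlinarith

theorem CR'_pos (h : P.Admissible) : 0 < P.CR' := by
  have h1 := h.lamMin_pos
  have h2 := h.lamMin_lt_lamMax
  have h3 : 1 < P.κ' := (one_lt_div h1).2 h2
  unfold CR'
  apply div_pos <;> linarith

theorem CR'_lt_one (h : P.Admissible) : P.CR' < 1 := by
  have h1 := h.μ_mul_lamMin
  have := mul_pos h.μ_pos h.lamMin_pos
  linarith

/-- The number of inner iterations is large enough. -/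
theorem CR'_pow_le (h : P.Admissible) : P.CR' ^ (P.L - 1).toNat ≤ P.Δ / 4 * √(1 + P.γ') := by
  have h0 := h.CR'_pos
  have hΔ := h.Δ_pos
  have hγ := h.γ'_pos
  have hlog : 0 < -Real.log P.CR' := neg_pos.2 (Real.log_neg h0 h.CR'_lt_one)
  have h1 : (-Real.log (P.Δ / 4) - 1 / 2 * Real.log (P.γ' + 1)) / (-Real.log P.CR') ≤
      ((P.L - 1).toNat : ℝ) := by
    refine (Int.le_ceil _).trans ?_
    have : P.L - 1 = ⌈(-Real.log (P.Δ / 4) - 1 / 2 * Real.log (P.γ' + 1)) /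
      (-Real.log P.CR')⌉ := by unfold L; ring
    rw [← this]
    -- Truncating a negative `L - 1` to `0` only enlarges the exponent.
    exact_mod_cast Int.self_le_toNat _
  rw [div_le_iff₀ hlog] at h1
  rw [← Real.log_le_log_iff (by positivity) (by positivity), Real.log_pow,
    Real.log_mul (by positivity) (by positivity), Real.log_sqrt (by positivity), add_comm 1]
  linarith

/-! ### The inner loop as a contraction -/

/-- Feasible vectors with few large entries are close to each other. -/
theorem norm_sub_le (h : P.Admissible) {σ : ℝ} (hσ : 0 ≤ σ) {s t : EuclideanSpace ℝ (Fin m)}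
    (hst : act P.A s = act P.A t) (hs : 2 * (large σ s).card ≤ P.n₀)
    (ht : 2 * (large σ t).card ≤ P.n₀) : ‖s - t‖ ≤ 2 * σ * √(m * (1 + P.γ)) := by
  have hγ := h.γ_nonneg
  set I := large σ s ∪ large σ t with hI
  have hc : I.card ≤ P.n₀ := by
    have : I.card ≤ _ := Finset.card_union_le (large σ s) (large σ t)
    omega
  have h1 := h.null I hc (s - t) (by rw [act_sub, hst, sub_self])
  have h2 : ∑ i ∈ Iᶜ, (s - t) i ^ 2 ≤ m * (2 * σ) ^ 2 := by
    have h3 : ∀ i ∈ Iᶜ, (s - t) i ^ 2 ≤ (2 * σ) ^ 2 := by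
      intro i hi
      simp only [hI, large, Finset.mem_compl, Finset.mem_union, Finset.mem_filter,
        Finset.mem_univ, true_and, not_or, not_lt] at hi
      rw [← sq_abs, PiLp.sub_apply]
      have := abs_sub (s i) (t i)
      have : |s i - t i| ≤ 2 * σ := by linarith [hi.1, hi.2]
      gcongr
    refine (Finset.sum_le_card_nsmul _ _ _ h3).trans ?_
    rw [nsmul_eq_mul]
    have : (Iᶜ.card : ℝ) ≤ m := by exact_mod_cast (Finset.card_le_univ _).trans (by simp)
    gcongr
  have h3 : ‖s - t‖ ^ 2 ≤ (1 + P.γ) * (m * (2 * σ) ^ 2) := by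
    rw [EuclideanSpace.real_norm_sq_eq, ← Finset.sum_add_sum_compl I]
    nlinarith
  refine abs_le_of_sq_le_sq' ?_ (by positivity) |>.2
  rw [mul_pow, Real.sq_sqrt (by positivity)]
  linarith

/-- The diagonal form arising from difference quotients of the gradient is positive definite on the
null space if few entries deviate from the curvature at the origin. -/
theorem quadratic_bounds (h : P.Admissible) {d : Fin m → ℝ} (h1 : ∀ i, -(2 / (P.γ' ^ 2 + P.γ')) ≤ d i)
    (h2 : ∀ i, d i ≤ 2 / (1 + P.γ')) {I : Finset (Fin m)} (hI : I.card ≤ P.n₀)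
    (hd : ∀ i ∈ Iᶜ, d i = 2 / (1 + P.γ')) {w : EuclideanSpace ℝ (Fin m)} (hw : act P.A w = 0) :
    P.lamMin * ‖w‖ ^ 2 ≤ ∑ i, d i * w i ^ 2 ∧ ∑ i, d i * w i ^ 2 ≤ P.lamMax * ‖w‖ ^ 2 := by
  have hγ := h.γ_nonneg
  have hγ' := h.γ'_pos
  have hγγ' := h.γ_lt_γ'
  have hlam := h.lamMin_pos
  rw [EuclideanSpace.real_norm_sq_eq]
  constructor
  · have hn := h.null I hI w hw
    rw [← Finset.sum_add_sum_compl I, ← Finset.sum_add_sum_compl I (fun i => d i * w i ^ 2)]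
    have e1 : ∑ i ∈ Iᶜ, d i * w i ^ 2 = 2 / (1 + P.γ') * ∑ i ∈ Iᶜ, w i ^ 2 := by
      rw [Finset.mul_sum]
      exact Finset.sum_congr rfl fun i hi => by rw [hd i hi]
    have e2 : -(2 / (P.γ' ^ 2 + P.γ')) * ∑ i ∈ I, w i ^ 2 ≤ ∑ i ∈ I, d i * w i ^ 2 := by
      rw [Finset.mul_sum]
      exact Finset.sum_le_sum fun i _ => mul_le_mul_of_nonneg_right (h1 i) (sq_nonneg _)
    -- This identity explains `lamMin`: it is what remains of the curvature off `I` when the mass on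
    -- `I` is `γ` times that off `I` and has the most negative curvature.
    have e3 : 2 / (1 + P.γ') = 2 / (P.γ' ^ 2 + P.γ') * P.γ + P.lamMin * (1 + P.γ) := by
      unfold lamMin
      field_simp
      ring
    have hb : 0 < 2 / (P.γ' ^ 2 + P.γ') := by positivity
    rw [e3] at e1
    have := mul_le_mul_of_nonneg_left hn (add_pos hb hlam).le
    linarith
  · rw [Finset.mul_sum]
    refine Finset.sum_le_sum fun i _ => mul_le_mul_of_nonneg_right ((h2 i).trans ?_) (sq_nonneg _)
    unfold lamMax
    gcongr

/-- A step contracts distances between feasible vectors with few large entries. -/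
theorem norm_step_sub_step_le (h : P.Admissible) {σ : ℝ} (hσ : 0 < σ) {s t : EuclideanSpace ℝ (Fin m)}
    (hst : act P.A s = act P.A t) (hs : 2 * (large σ s).card ≤ P.n₀)
    (ht : 2 * (large σ t).card ≤ P.n₀) : ‖P.step σ s - P.step σ t‖ ≤ P.CR' * ‖s - t‖ := by
  choose d h1 h2 h3 h4 using fun i => splineDeriv_slope h.γ'_pos (s i / σ) (t i / σ)
  set I := large σ s ∪ large σ t with hI
  have hc : I.card ≤ P.n₀ := by
    have : I.card ≤ _ := Finset.card_union_le (large σ s) (large σ t)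
    omega
  have hd : ∀ i ∈ Iᶜ, d i = 2 / (1 + P.γ') := by
    intro i hi
    simp only [hI, large, Finset.mem_compl, Finset.mem_union, Finset.mem_filter,
      Finset.mem_univ, true_and, not_or, not_lt] at hi
    apply h3 i <;> rw [abs_div, abs_of_pos hσ, div_le_one hσ]
    exacts [hi.1, hi.2]
  have hv : act P.A (s - t) = 0 := by rw [act_sub, hst, sub_self]
  set v := s - t with hvdef
  -- The factor `σ²` cancels the two factors `1/σ` from the gradient and its difference quotient,
  -- leaving a diagonal map independent of `σ` apart from `d`.
  let u : EuclideanSpace ℝ (Fin m) := WithLp.toLp 2 fun i => (1 - P.μ * d i) * v i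
  have hu : P.step σ s - P.step σ t = act (P.Dᵀ * P.D) u := by
    have e : u = v + (P.μ * σ ^ 2) • (∇ (cost P.γ' σ) s - ∇ (cost P.γ' σ) t) := by
      rw [(hasGradientAt_cost h.γ'_pos σ s).gradient, (hasGradientAt_cost h.γ'_pos σ t).gradient]
      ext i
      simp only [u, hvdef, PiLp.add_apply, PiLp.sub_apply, PiLp.smul_apply, smul_eq_mul]
      rw [← sub_div, h4 i, ← sub_div]
      field_simp
      ring
    rw [e, act_add, h.proj_eq_self hv, act_smul, act_sub]
    unfold step
    module
  rw [hu]
  refine norm_compression_le h.CR'_pos (fun i => 1 - P.μ * d i)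
    (LinearMap.ker (Matrix.toEuclideanLin P.A)) (fun w hw => ?_) hv (h.act_A_proj u) ?_
  · obtain ⟨ha, hb⟩ := h.quadratic_bounds h1 h2 hc hd hw
    have e : ∑ i, (1 - P.μ * d i) * w i ^ 2 = ‖w‖ ^ 2 - P.μ * ∑ i, d i * w i ^ 2 := by
      rw [EuclideanSpace.real_norm_sq_eq, Finset.mul_sum, ← Finset.sum_sub_distrib]
      exact Finset.sum_congr rfl fun i _ => by ring
    have ha' := mul_le_mul_of_nonneg_left ha h.μ_pos.le
    have hb' := mul_le_mul_of_nonneg_left hb h.μ_pos.le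
    rw [← mul_assoc, h.μ_mul_lamMin] at ha'
    rw [← mul_assoc, h.μ_mul_lamMax] at hb'
    rw [e, abs_le]
    constructor <;> linarith
  · rw [h.norm_proj_sq_eq]
    simp [u, PiLp.inner_apply, mul_comm]

theorem act_step (h : P.Admissible) (σ : ℝ) (s : EuclideanSpace ℝ (Fin m)) : act P.A (P.step σ s) = act P.A s := by
  rw [step, act_add, act_smul, h.act_A_proj, smul_zero, add_zero]

/-- The projected steepest ascent steps do not decrease the cost function. -/
theorem cost_le_cost_step (h : P.Admissible) {σ : ℝ} (hσ : 0 < σ) (s : EuclideanSpace ℝ (Fin m)) :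
    cost P.γ' σ s ≤ cost P.γ' σ (P.step σ s) := by
  have hγ' := h.γ'_pos
  have hμ := h.μ_pos
  refine le_trans ?_ (cost_quadratic_lower hγ' σ s _)
  rw [inner_smul_right, ← h.norm_proj_sq_eq, norm_smul, mul_pow, Real.norm_eq_abs, sq_abs]
  set W := ‖act (P.Dᵀ * P.D) (∇ (cost P.γ' σ) s)‖ ^ 2
  have e : (P.μ * σ ^ 2) ^ 2 * W / (σ ^ 2 * (1 + P.γ')) =
      P.μ * σ ^ 2 * W * (P.μ / (1 + P.γ')) := by field_simp
  have h1 : P.μ / (1 + P.γ') ≤ 1 := (div_le_one (by positivity)).2 h.μ_le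
  have h2 : 0 ≤ P.μ * σ ^ 2 * W := by positivity
  rw [e]
  nlinarith

theorem iterate_step (h : P.Admissible) {σ : ℝ} (hσ : 0 < σ) (s : EuclideanSpace ℝ (Fin m)) (N : ℕ) :
    act P.A ((P.step σ)^[N] s) = act P.A s ∧
      cost P.γ' σ s ≤ cost P.γ' σ ((P.step σ)^[N] s) := by
  induction N with
  | zero => exact ⟨rfl, le_rfl⟩
  | succ N ih =>
    rw [Function.iterate_succ_apply']
    exact ⟨(h.act_step σ _).trans ih.1, ih.2.trans (h.cost_le_cost_step hσ _)⟩

theorem norm_iterate_sub_iterate_le (h : P.Admissible) {σ : ℝ} (hσ : 0 < σ) {s t : EuclideanSpace ℝ (Fin m)}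
    (hst : act P.A s = act P.A t) (hs : m - P.n₀ / (2 * (1 + P.γ')) ≤ cost P.γ' σ s)
    (ht : m - P.n₀ / (2 * (1 + P.γ')) ≤ cost P.γ' σ t) (N : ℕ) :
    ‖(P.step σ)^[N] s - (P.step σ)^[N] t‖ ≤ P.CR' ^ N * ‖s - t‖ := by
  induction N with
  | zero => simp
  | succ N ih =>
    obtain ⟨h1, h2⟩ := h.iterate_step hσ s N
    obtain ⟨h3, h4⟩ := h.iterate_step hσ t N
    rw [Function.iterate_succ_apply', Function.iterate_succ_apply', pow_succ', mul_assoc]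
    refine (h.norm_step_sub_step_le hσ (by rw [h1, h3, hst])
      (card_large_le h.γ'_pos hσ (hs.trans h2)) (card_large_le h.γ'_pos hσ (ht.trans h4))).trans ?_
    exact mul_le_mul_of_nonneg_left ih h.CR'_pos.le

/-- The inner loop nearly attains the value of the cost function at any feasible vector. -/
theorem cost_sub_le_cost_iterate (h : P.Admissible) {σ : ℝ} (hσ : 0 < σ) {s t : EuclideanSpace ℝ (Fin m)}
    (hst : act P.A s = act P.A t) (hs : m - P.n₀ / (2 * (1 + P.γ')) ≤ cost P.γ' σ s)
    (ht : m - P.n₀ / (2 * (1 + P.γ')) ≤ cost P.γ' σ t) :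
    cost P.γ' σ t - m * P.Δ ≤ cost P.γ' σ ((P.step σ)^[(P.L - 1).toNat] s) := by
  have hγ := h.γ_nonneg
  have hγ' := h.γ'_pos
  have hΔ := h.Δ_pos
  set N := (P.L - 1).toNat with hN
  have h1 := h.norm_iterate_sub_iterate_le hσ hst hs ht N
  have h2 := h.norm_sub_le hσ.le hst (card_large_le hγ' hσ hs) (card_large_le hγ' hσ ht)
  have h3 : √(m * (1 + P.γ)) ≤ √m * √(1 + P.γ') := by
    rw [← Real.sqrt_mul (by positivity)]
    gcongr
    exact h.γ_lt_γ'.le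
  have h4 : ‖(P.step σ)^[N] s - (P.step σ)^[N] t‖ ≤
      P.Δ / 4 * √(1 + P.γ') * (2 * σ * (√m * √(1 + P.γ'))) :=
    h1.trans (mul_le_mul h.CR'_pow_le (h2.trans (by gcongr)) (norm_nonneg _) (by positivity))
  have h5 : 2 / (1 + P.γ') * (√m * ‖(P.step σ)^[N] s - (P.step σ)^[N] t‖ / σ) ≤ m * P.Δ := by
    calc _ ≤ 2 / (1 + P.γ') *
          (√m * (P.Δ / 4 * √(1 + P.γ') * (2 * σ * (√m * √(1 + P.γ')))) / σ) := by gcongr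
      _ = √m ^ 2 * P.Δ * (√(1 + P.γ') ^ 2 / (1 + P.γ')) := by field_simp; ring
      _ = m * P.Δ := by
        rw [Real.sq_sqrt (by positivity), Real.sq_sqrt (by positivity), div_self (by positivity),
          mul_one]
  -- The comparison is with the iterate of `t`, since `t` itself need not be a fixed point.
  have h6 := cost_sub_le_of_norm hγ' hσ ((P.step σ)^[N] s) ((P.step σ)^[N] t)
  have h7 := (h.iterate_step hσ t N).2
  linarith

/-! ### The sequence of `σ` and the outer loop -/

theorem cost_initial (h : P.Admissible) (hσ : 0 < P.σ₁) :
    m - P.n₀ / (2 * (1 + P.γ')) ≤ cost P.γ' P.σ₁ (act P.Aᵀ P.x) := by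
  have hγ' := h.γ'_pos
  have hn := h.n₀_pos
  refine le_trans ?_ (sub_sq_le_cost hγ' _)
  have e : ‖act P.Aᵀ P.x‖ ^ 2 = P.σ₁ ^ 2 * (P.n₀ / (2 + 2 * P.γ')) := by
    have h1 : ‖act P.Aᵀ P.x‖ = P.σ₁ * √(P.n₀ / (2 + 2 * P.γ')) := by
      unfold σ₁
      rw [div_mul_cancel₀ _ (by positivity)]
    rw [h1, mul_pow, Real.sq_sqrt (by positivity)]
  have e2 : P.σ₁ ^ 2 * (P.n₀ / (2 + 2 * P.γ')) / (P.σ₁ ^ 2 * (1 + P.γ')) =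
      P.n₀ / (2 * (1 + P.γ')) / (1 + P.γ') := by
    field_simp
  rw [e, e2]
  have : P.n₀ / (2 * (1 + P.γ')) / (1 + P.γ') ≤ P.n₀ / (2 * (1 + P.γ')) :=
    div_le_self (by positivity) (by linarith)
  linarith

theorem log_one_add_pos (h : P.Admissible) : 0 < Real.log (1 + P.Δ / 2) :=
  Real.log_pos (by linarith [h.Δ_pos])

theorem σ₁_le_σlast (h : P.Admissible) (hσ : 0 < P.σ₁) (hl : 0 < P.σlast) (hJ : P.J ≤ 1) :
    P.σ₁ ≤ P.σlast := by
  have hlog := h.log_one_add_pos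
  have h1 : ⌈(Real.log P.σ₁ - Real.log P.σlast) / Real.log (1 + P.Δ / 2)⌉ ≤ 0 := by
    unfold J at hJ; linarith
  have h2 := Int.ceil_le.1 h1
  rw [div_le_iff₀ hlog, Int.cast_zero, zero_mul, sub_nonpos] at h2
  exact (Real.log_le_log_iff hσ hl).1 h2

/-- If `J = 1`, then `σ₁` may be below `σlast`, but rounding up limits this to a factor `1 + Δ/2`.
Hence the slack in the later hypotheses on `t`. -/
theorem σlast_le_mul_σ₁ (h : P.Admissible) (hσ : 0 < P.σ₁) (hl : 0 < P.σlast) (hJ : 1 ≤ P.J) :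
    P.σlast ≤ (1 + P.Δ / 2) * P.σ₁ := by
  have hlog := h.log_one_add_pos
  have hΔ := h.Δ_pos
  have h1 : -1 < ⌈(Real.log P.σ₁ - Real.log P.σlast) / Real.log (1 + P.Δ / 2)⌉ := by
    unfold J at hJ; linarith
  have h2 := Int.lt_ceil.1 h1
  rw [lt_div_iff₀ hlog] at h2
  rw [← Real.log_le_log_iff hl (by positivity), Real.log_mul (by positivity) hσ.ne']
  push_cast at h2
  linarith

theorem c_bounds (h : P.Admissible) (hσ : 0 < P.σ₁) (hl : 0 < P.σlast) (hJ : 2 ≤ P.J) :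
    P.c ≤ 1 ∧ 1 ≤ P.c * (1 + P.Δ / 2) ∧ P.σ P.J.toNat = P.σlast := by
  have hlog := h.log_one_add_pos
  have hΔ := h.Δ_pos
  set q := Real.log P.σ₁ - Real.log P.σlast with hq
  have hJe : P.J = ⌈q / Real.log (1 + P.Δ / 2)⌉ + 1 := rfl
  have h1 : 0 < ⌈q / Real.log (1 + P.Δ / 2)⌉ := by linarith
  have h2 : 0 < q := by
    have := Int.lt_ceil.1 h1
    rw [lt_div_iff₀ hlog] at this
    simpa using this
  have h3 : q / Real.log (1 + P.Δ / 2) ≤ (P.J : ℝ) - 1 := by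
    rw [hJe]; push_cast; linarith [Int.le_ceil (q / Real.log (1 + P.Δ / 2))]
  have h4 : (0 : ℝ) < (P.J : ℝ) - 1 := lt_of_lt_of_le (by positivity) h3
  have hc : P.c = Real.exp (-(q / ((P.J : ℝ) - 1))) := rfl
  refine ⟨?_, ?_, ?_⟩
  · rw [hc, Real.exp_le_one_iff, neg_nonpos]
    positivity
  · rw [div_le_iff₀ hlog] at h3
    have h5 : q / ((P.J : ℝ) - 1) ≤ Real.log (1 + P.Δ / 2) := by
      rw [div_le_iff₀ h4]; linarith
    rw [hc, ← Real.exp_log (by positivity : 0 < 1 + P.Δ / 2), ← Real.exp_add,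
      Real.one_le_exp_iff]
    linarith
  · unfold σ
    have h6 : ((P.J.toNat - 1 : ℕ) : ℝ) = (P.J : ℝ) - 1 := by
      have : ((P.J.toNat - 1 : ℕ) : ℤ) = P.J - 1 := by omega
      exact_mod_cast this
    rw [hc, ← Real.exp_nat_mul, h6]
    have h7 : ((P.J : ℝ) - 1) * -(q / ((P.J : ℝ) - 1)) = Real.log P.σlast - Real.log P.σ₁ := by
      rw [hq]; field_simp; ring
    rw [h7, Real.exp_sub, Real.exp_log hl, Real.exp_log hσ]
    field_simp

theorem σ_pos (hσ : 0 < P.σ₁) (j : ℕ) : 0 < P.σ j :=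
  mul_pos hσ (pow_pos (Real.exp_pos _) _)

theorem σlast_le_mul_σ (h : P.Admissible) (hσ : 0 < P.σ₁) (hl : 0 < P.σlast) {j : ℕ}
    (h1 : 1 ≤ j) (hj : j ≤ P.J.toNat) : P.σlast ≤ (1 + P.Δ / 2) * P.σ j := by
  have hΔ := h.Δ_pos
  rcases h1.eq_or_lt with rfl | h2
  · simpa [σ] using h.σlast_le_mul_σ₁ hσ hl (by omega)
  · obtain ⟨hc1, -, hlast⟩ := h.c_bounds hσ hl (by omega)
    have hc0 : 0 < P.c := Real.exp_pos _
    have : P.σ P.J.toNat ≤ P.σ j :=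
      mul_le_mul_of_nonneg_left (pow_le_pow_of_le_one hc0.le hc1 (by omega)) hσ.le
    have hp := σ_pos hσ j
    rw [hlast] at this
    nlinarith

/-- The outer loop, compared with a feasible vector `t` at which the cost functions are large. -/
theorem estimate_spec (h : P.Admissible) (hσ : 0 < P.σ₁) (hl : 0 < P.σlast)
    {t : EuclideanSpace ℝ (Fin m)} (htA : act P.A t = P.x)
    (ht : ∀ σ, 0 < σ → P.σlast ≤ (1 + P.Δ / 2) * σ → m - P.k - m * P.Δ ≤ cost P.γ' σ t)
    {j : ℕ} (hj : j + 1 ≤ P.J.toNat) :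
    act P.A (P.estimate j) = P.x ∧
      m - P.n₀ / (2 * (1 + P.γ')) ≤ cost P.γ' (P.σ (j + 1)) (P.estimate j) ∧
      act P.A (P.estimate (j + 1)) = P.x ∧
      m - P.k - 2 * m * P.Δ ≤ cost P.γ' (P.σ (j + 1)) (P.estimate (j + 1)) := by
  have hlev := h.div_one_add_γ'
  have hmΔ : 0 < m * P.Δ := mul_pos h.m_pos h.Δ_pos
  have key : ∀ j, j + 1 ≤ P.J.toNat → act P.A (P.estimate j) = P.x →
      m - P.n₀ / (2 * (1 + P.γ')) ≤ cost P.γ' (P.σ (j + 1)) (P.estimate j) →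
      act P.A (P.estimate (j + 1)) = P.x ∧
      m - P.k - 2 * m * P.Δ ≤ cost P.γ' (P.σ (j + 1)) (P.estimate (j + 1)) := by
    intro j hj hA hc
    have hp := σ_pos hσ (j + 1)
    have ht' := ht _ hp (h.σlast_le_mul_σ hσ hl (by omega) hj)
    refine ⟨(h.iterate_step hp _ _).1.trans hA, ?_⟩
    have := h.cost_sub_le_cost_iterate hp (hA.trans htA.symm) hc (by linarith)
    rw [estimate]
    linarith
  induction j with
  | zero =>
    have hA : act P.A (P.estimate 0) = P.x := by
      rw [estimate, act_act, h.rows_A, act_one]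
    have hc : m - P.n₀ / (2 * (1 + P.γ')) ≤ cost P.γ' (P.σ (0 + 1)) (P.estimate 0) := by
      simpa [σ, estimate] using h.cost_initial hσ
    exact ⟨hA, hc, key 0 hj hA hc⟩
  | succ j ih =>
    obtain ⟨-, -, hA, hc⟩ := ih (by omega)
    obtain ⟨hc1, hc2, -⟩ := h.c_bounds hσ hl (by omega)
    have e : P.σ (j + 1 + 1) = P.σ (j + 1) * P.c := by
      simp [σ, pow_succ, mul_assoc]
    have hc' : m - P.n₀ / (2 * (1 + P.γ')) ≤ cost P.γ' (P.σ (j + 1 + 1)) (P.estimate (j + 1)) := by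
      have := cost_sub_le_cost_mul (σ := P.σ (j + 1)) (c := P.c) h.γ'_pos (Real.exp_pos _) hc1 hc2
        (P.estimate (j + 1))
      rw [e]
      linarith
    exact ⟨hA, hc', key (j + 1) hj hA hc'⟩

/-- Here `Real.log 0 = 0` makes `J` meaningless, so every `j` is covered. -/
theorem estimate_of_σ₁_eq_zero (hσ : P.σ₁ = 0) (j : ℕ) : P.estimate j = act P.Aᵀ P.x := by
  induction j with
  | zero => rfl
  | succ j ih =>
    have hstep : P.step (P.σ (j + 1)) = id := by
      funext s
      simp [step, σ, hσ]
    rw [estimate, hstep, Function.iterate_id, id, ih]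

/-- The output is feasible and has few entries greater than the last value of `σ`. -/
theorem output_spec (h : P.Admissible) (hl : 0 < P.σlast)
    {t : EuclideanSpace ℝ (Fin m)} (htA : act P.A t = P.x)
    (ht : ∀ σ, 0 < σ → P.σlast ≤ (1 + P.Δ / 2) * σ → m - P.k - m * P.Δ ≤ cost P.γ' σ t) :
    act P.A P.output = P.x ∧ 2 * (large P.σlast P.output).card ≤ P.n₀ := by
  have hγ' := h.γ'_pos
  have hn := h.n₀_pos
  have hA : act P.A (act P.Aᵀ P.x) = P.x := by rw [act_act, h.rows_A, act_one]
  have hmono : ∀ {τ : ℝ} {s : EuclideanSpace ℝ (Fin m)}, τ ≤ P.σlast →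
      2 * (large τ s).card ≤ P.n₀ → 2 * (large P.σlast s).card ≤ P.n₀ := fun hτ hs =>
    (Nat.mul_le_mul_left 2 (Finset.card_le_card (large_subset hτ _))).trans hs
  have h0 : 0 ≤ P.σ₁ := by unfold σ₁; positivity
  rcases h0.eq_or_lt with hσ | hσ
  · have hz : act P.Aᵀ P.x = 0 := by
      have hs : √(P.n₀ / (2 + 2 * P.γ')) ≠ 0 := by positivity
      have := hσ.symm
      unfold σ₁ at this
      rw [div_eq_zero_iff, or_iff_left hs, norm_eq_zero] at this
      exact this
    rw [output, estimate_of_σ₁_eq_zero hσ.symm]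
    refine ⟨hA, ?_⟩
    rw [hz]
    simp [large, hl.le.not_gt]
  -- With an empty loop the start already suffices, because then `σ₁ ≤ σlast`.
  · by_cases hJ : P.J ≤ 0
    · have : P.output = act P.Aᵀ P.x := by rw [output, Int.toNat_of_nonpos hJ]; rfl
      rw [this]
      exact ⟨hA, hmono (h.σ₁_le_σlast hσ hl (by omega)) (card_large_le hγ' hσ (h.cost_initial hσ))⟩
    · obtain ⟨j, hj⟩ : ∃ j, P.J.toNat = j + 1 := ⟨P.J.toNat - 1, by omega⟩
      obtain ⟨-, -, h1, h2⟩ := h.estimate_spec hσ hl htA ht hj.ge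
      have hout : P.output = P.estimate (j + 1) := by rw [output, hj]
      rw [hout]
      refine ⟨h1, hmono ?_ (card_large_le hγ' (σ_pos hσ (j + 1)) (le_trans ?_ h2))⟩
      · by_cases hJ1 : P.J ≤ 1
        · obtain rfl : j = 0 := by omega
          simpa [σ] using h.σ₁_le_σlast hσ hl hJ1
        · rw [← hj, (h.c_bounds hσ hl (by omega)).2.2]
      · have := mul_pos h.m_pos h.Δ_pos
        rw [h.div_one_add_γ']
        linarith

/-! ### Noise and the final error bound -/

/-- The cost functions are large at a sparse vector up to a small perturbation. -/
theorem le_cost_add (h : P.Admissible) {e : ℝ} (he : 4 / (P.Δ * √(P.γ + 1)) * e ≤ P.δ')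
    {s w : EuclideanSpace ℝ (Fin m)} (hs : l0 s ≤ P.k) (hw : ‖w‖ ≤ e)
    {σ : ℝ} (hσ : 0 < σ) (hσl : P.σlast ≤ (1 + P.Δ / 2) * σ) :
    m - P.k - m * P.Δ ≤ cost P.γ' σ (s + w) := by
  have hγ := h.γ_nonneg
  have hγ' := h.γ'_pos
  have hΔ := h.Δ_pos
  have hm := h.m_pos
  refine le_trans ?_ (sub_l0_sub_le_cost_add hγ' s w)
  have hs' : (l0 s : ℝ) ≤ P.k := by exact_mod_cast hs
  have h1 : 4 * ‖w‖ ≤ P.δ' * (P.Δ * √(P.γ + 1)) := by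
    rw [div_mul_eq_mul_div, div_le_iff₀ (by positivity)] at he
    linarith
  have h2 : P.δ' ≤ (1 + P.Δ / 2) * σ * (2 * √(m * (P.γ' + 1))) := by
    unfold σlast at hσl
    rwa [div_le_iff₀ (by positivity)] at hσl
  have h3 : (4 * ‖w‖) ^ 2 ≤
      ((1 + P.Δ / 2) * σ * (2 * √(m * (P.γ' + 1))) * (P.Δ * √(P.γ + 1))) ^ 2 := by
    refine pow_le_pow_left₀ (by positivity) (h1.trans ?_) 2
    gcongr
  rw [mul_pow, mul_pow _ (P.Δ * √(P.γ + 1)), mul_pow _ (2 * √(m * (P.γ' + 1))), mul_pow 2,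
    mul_pow P.Δ, mul_pow _ σ, Real.sq_sqrt (by positivity), Real.sq_sqrt (by positivity)] at h3
  -- The squared noise term is at most `mΔ` times `(1+Δ/2)² Δ(1+γ)/4`, and `Δ(1+γ) ≤ 1/8` leaves
  -- ample room.
  have h4 : ‖w‖ ^ 2 / (σ ^ 2 * (1 + P.γ')) ≤ m * P.Δ := by
    rw [div_le_iff₀ (by positivity)]
    have h5 : (1 + P.Δ / 2) ^ 2 ≤ 4 := by nlinarith [h.Δ_le]
    have h6 := h.Δ_mul_le
    have h7 : (1 + P.Δ / 2) ^ 2 * (P.Δ * (1 + P.γ)) ≤ 4 * 1 := by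
      gcongr
      linarith
    have h8 : 0 ≤ 4 * m * P.Δ * (σ ^ 2 * (1 + P.γ')) := by positivity
    have h9 := mul_le_mul_of_nonneg_left h7 h8
    have e1 : (1 + P.Δ / 2) ^ 2 * σ ^ 2 * (2 ^ 2 * (m * (P.γ' + 1))) * (P.Δ ^ 2 * (P.γ + 1)) =
      4 * m * P.Δ * (σ ^ 2 * (1 + P.γ')) * ((1 + P.Δ / 2) ^ 2 * (P.Δ * (1 + P.γ))) := by ring
    rw [e1] at h3
    linarith
  linarith

theorem norm_output_sub_le (h : P.Admissible) {s : EuclideanSpace ℝ (Fin m)}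
    {noise : EuclideanSpace ℝ (Fin n)} (hx : P.x = act P.A s + noise) (hnoise : ‖noise‖ ≤ P.ε)
    (hs : l0 s ≤ P.k) (hδ : P.C * P.ε < P.δ) : ‖P.output - s‖ ≤ P.δ := by
  have hγ := h.γ_nonneg
  have hγ' := h.γ'_pos
  have hΔ := h.Δ_pos
  have hm := h.m_pos
  have hε : 0 ≤ P.ε := (norm_nonneg _).trans hnoise
  have hA0 : 0 ≤ specNorm P.A := norm_nonneg _
  have hC : 4 / (P.Δ * √(P.γ + 1)) * (specNorm P.A * P.ε) < P.δ' := by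
    unfold δ'; unfold C at hδ; linarith
  have hδ' : 0 < P.δ' := lt_of_le_of_lt (by positivity) hC
  have hl : 0 < P.σlast := by unfold σlast; positivity
  set w := act P.Aᵀ noise with hwdef
  have hw : ‖w‖ ≤ specNorm P.A * P.ε :=
    (norm_act_transpose_le h.rows_A noise).trans (mul_le_mul_of_nonneg_left hnoise hA0)
  have htA : act P.A (s + w) = P.x := by
    rw [act_add, hwdef, act_act, h.rows_A, act_one, hx]
  have ht : ∀ σ, 0 < σ → P.σlast ≤ (1 + P.Δ / 2) * σ →
      m - P.k - m * P.Δ ≤ cost P.γ' σ (s + w) := fun σ hσ hσl =>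
    h.le_cost_add hC.le hs hw hσ hσl
  obtain ⟨h1, h2⟩ := h.output_spec hl htA ht
  have h3 : 2 * (large P.σlast (s + w)).card ≤ P.n₀ := by
    refine card_large_le hγ' hl (le_trans ?_ (ht _ hl (by nlinarith)))
    have := mul_pos hm hΔ
    rw [h.div_one_add_γ']
    linarith
  have h4 := h.norm_sub_le hl.le (h1.trans htA.symm) h2 h3
  -- `σlast` is chosen so that replacing `γ` by `γ'` turns the left side into exactly `δ'`; the rest
  -- of `δ` pays for `‖w‖`.
  have h5 : 2 * P.σlast * √(m * (1 + P.γ)) ≤ P.δ' := by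
    have h6 : √(m * (1 + P.γ)) ≤ √(m * (P.γ' + 1)) := by
      refine Real.sqrt_le_sqrt (mul_le_mul_of_nonneg_left ?_ hm.le)
      linarith [h.γ_lt_γ']
    have h7 : P.σlast * (2 * √(m * (P.γ' + 1))) = P.δ' := by
      unfold σlast
      rw [div_mul_cancel₀ _ (by positivity)]
    have h8 := mul_le_mul_of_nonneg_left h6 hl.le
    linarith
  have h6 : ‖P.output - s‖ ≤ ‖P.output - (s + w)‖ + ‖w‖ := by
    have e : P.output - s = P.output - (s + w) + w := by abel
    rw [e]
    exact norm_add_le _ _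
  unfold δ' at h5
  linarith

end Admissible

end Input

end SL0

theorem mainTheorem7 {n m : ℕ} (hnm : n < m)
    (A : Matrix (Fin n) (Fin m) ℝ) (hA : A * Aᵀ = 1)
    (D : Matrix (Fin (m - n)) (Fin m) ℝ) (hD : D * Dᵀ = 1) (hAD : A * Dᵀ = 0)
    (n₀ : ℕ) (γ : ℝ) (hfin : SL0.gammaConst A n₀ ≠ ⊤) (hγ : γ = (SL0.gammaConst A n₀).toReal)
    (s₀ : EuclideanSpace ℝ (Fin m)) (noise x : EuclideanSpace ℝ (Fin n))
    (k : ℕ) (ε δ : ℝ)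
    (hx : x = SL0.act A s₀ + noise) (hnoise : ‖noise‖ ≤ ε)
    (hs₀ : SL0.l0 s₀ ≤ k) (hk : (k : ℝ) < n₀ / (2 * (1 + γ)))
    (P : SL0.Input n m)
    (hP : P = { A := A, D := D, x := x, n₀ := n₀, γ := γ, k := k, ε := ε, δ := δ })
    (hδ : P.C * ε < δ) :
    ‖P.output - s₀‖ ≤ δ := by
  subst hP
  exact SL0.Input.Admissible.norm_output_sub_le
    { lt := hnm
      rows_A := hA
      rows_D := hD
      orthogonal := hAD
      γ_nonneg := hγ ▸ ENNReal.toReal_nonneg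
      null := fun _ hI _ hs => hγ ▸ SL0.sum_sq_le_gammaConst hfin hI hs
      sparse := hk } hx hnoise hs₀ hδ
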